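/- \textbf{Setting.} Types are the simple types over one atom $o$, with $\mathrm{ord}(o)=0$ and $\mathrm{ord}(A\to B)=\max(\mathrm{ord}(A)+1,\mathrm{ord}(B))$. A recursion scheme $G$ consists of a ranked alphabet of terminals, a finite set of typed non-terminals with a start symbol $S:o$, and, for each non-terminal $F:A_1\to\cdots\to A_m\to o$, exactly one rule $F z_1\cdots z_m\to e$, where $e:o$ is an applicative term over the terminals, the non-terminals and the parameters $z_i:A_i$. Its order $n$ is the largest order of a non-terminal; assume $n\ge 1$. \textbf{Computation graph and tree.} For each $F$ take the tree of the $\eta$-long normal form of $\lambda z_1\cdots z_m.e$: $\lambda$-nodes $\lambda x_1\cdots x_k$ ($k\ge0$) alternate with nodes labelled by a terminal, a variable, or $@$ (standing for an occurrence of a non-terminal together with all its arguments). The operands of a node are its children $E_1,E_2,\dots$; the unique child of a $\lambda$-node is its $E_1$; an $@$-node for the non-terminal $F$ has the root $\lambda$-node of the tree of $F$ as an additional child $E_0$, and $\lambda$-nodes reached in this way are called prime. The computation graph is the union of these trees with these additional edges; its unfolding from the root of the tree of $S$ is the computation tree of $G$. The order of $\lambda x_1\cdots x_k$ is $1+\max_i\mathrm{ord}(x_i)$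 if $k>0$ and $0$ if $k=0$; the order of a variable node is the order of its type. $G$ is \emph{incrementally-bound} if in every finite tree obtained by pruning the computation tree, every variable node $x$ (an occurrence of a parameter or of a variable introduced by $\eta$-expansion) is bound by the first $\lambda$-node of order $>\mathrm{ord}(x)$ on the path from $x$ to the root. \textbf{Stacks.} An order-$1$ stack is a sequence of symbols $a^{(j,k)}$, where $a$ is a node of the computation graph and $(j,k)$ is a link of order $j$ and height $k$ ($1\le j\le n$, $k\ge1$, and $k=1$ if $j=1$); an order-$(i+1)$ stack is a non-empty sequence of order-$i$ stacks. The empty stacks are $\bot_1=[\,]$ and $\bot_{i+1}=[\bot_i]$. $push_1\,a$ adds $a$ to the top order-$1$ stack; $pop_j$ removes the top order-$(j-1)$ stack (undefined if the result would not be a stack); for $j\ge2$, $push_j$ duplicates the top order-$(j-1)$ stack, replacing in the new copy every link $(j,k)$ by $(j,k+1)$; and $collapse$ performs $pop_j^k$, where $(j,k)$ is the link of the top symbol. The prefix $s_{\le\lambda}$ of $s$ at an occurrence $\lambda$ in the top order-$1$ stack of $s$ is obtained by removing everything above $\lambda$ from that order-$1$ stack. \textbf{The automaton $CPDA(G)$.}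 Configurations are order-$n$ stacks; the initial configurations are $push_1\,\lambda\,\bot_n$, with $\lambda$ the root of the tree of $S$. A step from a configuration with top node $u$ is one of the following (a link that is not mentioned is arbitrary): \begin{itemize} \item $u$ is an $@$-node: push $E_0(u)$ with link $(1,1)$; \item $u$ is a terminal $f$: push $E_i(u)$ for some $1\le i\le\mathrm{ar}(f)$; \item $u$ is a $\lambda$-node: push $E_1(u)$; \item $u$ is a variable of order $l\ge1$, the $i$-th variable of its binder and at distance $p$ from it: perform $push_{n-l+1}$, then $pop_1^p$, then $collapse$, then push $E_i(w)$ with link $(n-l+1,1)$, where $w$ is the top node just before this last push; \item $u$ is a variable of order $0$, the $i$-th variable of its binder and at distance $p$ from it: perform $pop_1^p$, then $collapse$, then push $E_i(w)$, where $w$ is the top node just before this last push. \end{itemize} A configuration is \emph{$\to$-reachable} if finitely many steps lead to it from an initial configuration. \textbf{Safety.} For $l\ge 0$, the order-decomposition $\mathrm{orddec}_l(s)$ of a stack $s$ is the sequence of occurrences $\lambda_r,\dots,\lambda_1$ ($r\ge 0$) in its top order-$1$ stack such that $\lambda_1$ is the topmost $\lambda$-node of order $>l$, each $\lambda_{q+1}$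 is the topmost $\lambda$-node below $\lambda_q$ of order $>\mathrm{ord}(\lambda_q)$, and $r$ is maximal. The relation ``$s$ is $l$-safe'' is the least relation such that a non-empty stack $s$ (that is, $s\ne\bot_{\mathrm{ord}(s)}$) is $l$-safe when \begin{enumerate} \item all links of the nodes of $\mathrm{orddec}_l(s)$ have height $1$; and \item for every $1\le q\le r$ with $n-\mathrm{ord}(\lambda_q)+1\le\mathrm{ord}(s)$, the stack $collapse(s_{\le\lambda_q})$ is defined, and it is $l$-safe if $q=1$ and $\mathrm{ord}(\lambda_{q-1})$-safe if $q>1$. \end{enumerate} A stack is \emph{safe} if it is $0$-safe. \textbf{Proposition.} Let $G$ be an incrementally-bound recursion scheme of order $n\ge1$. Then every $\to$-reachable configuration of $CPDA(G)$ is a safe stack. -/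

import Mathlib

universe u v

namespace Hors

/-! ## Simple types, applicative terms, recursion schemes -/

/-- Simple types over a single atom `o`. -/
inductive Ty : Type
  | o : Ty
  | arr : Ty → Ty → Ty

namespace Ty

/-- The order of a type: `ord o = 0`, `ord (A → B) = max (ord A + 1) (ord B)`. -/
def order : Ty → ℕ
  | o => 0
  | arr A B => max (A.order + 1) B.order

/-- The argument types `[A₁, …, Aₖ]` of `A₁ → ⋯ → Aₖ → o`. -/
def args : Ty → List Ty
  | o => []
  | arr A B => A :: B.args

/-- The type `o → ⋯ → o → o` with `k` arguments. -/
def ofArity : ℕ → Ty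
  | 0 => o
  | k + 1 => arr o (ofArity k)

end Ty

/-- Applicative terms generated from terminals (ranked by `ar`), non-terminals (typed by `ty`) and
parameters, the `i`-th parameter having the `i`-th type of the list `Z`. -/
inductive ATerm {T : Type u} {N : Type v} (ar : T → ℕ) (ty : N → Ty) (Z : List Ty) :
    Ty → Type (max u v)
  | term (f : T) : ATerm ar ty Z (Ty.ofArity (ar f))
  | nonterm (F : N) : ATerm ar ty Z (ty F)
  | param (i : Fin Z.length) : ATerm ar ty Z (Z.get i)
  | app {A B : Ty} : ATerm ar ty Z (Ty.arr A B) → ATerm ar ty Z A → ATerm ar ty Z B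

/-- A higher-order recursion scheme: a ranked alphabet of terminals, a finite set of typed
non-terminals with a start symbol of ground type, and for each non-terminal `F : A₁ → ⋯ → Aₘ → o`
exactly one rule `F z₁ ⋯ zₘ → rhs F`, whose right-hand side is an applicative term of type `o`
over the terminals, the non-terminals and the parameters `z₁ : A₁, …, zₘ : Aₘ`. -/
structure Scheme where
  Terminal : Type u
  arity : Terminal → ℕ
  NonTerm : Type v
  fintypeNonTerm : Fintype NonTerm
  ty : NonTerm → Ty
  start : NonTerm
  start_ty : ty start = Ty.o
  rhs : (F : NonTerm) → ATerm arity ty (ty F).args Ty.o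

/-- The order of a scheme: the highest order of its non-terminals. -/
def Scheme.order (G : Scheme.{u, v}) : ℕ :=
  letI := G.fintypeNonTerm
  Finset.univ.sup fun F => (G.ty F).order

/-! ## Computation trees of the rules -/

/-- The head of a body `s₀ s₁ ⋯ sₘ` of an η-long normal form. A variable is given by its type `A`,
the number `d` of `λ`-nodes strictly between the variable and its binder, and its (0-based) index
`i` in the list of variables bound by the binder. -/
inductive Head (T : Type u) (N : Type v) : Type (max u v)
  | term (f : T) : Head T N
  | nonterm (F : N) : Head T N
  | var (A : Ty) (d i : ℕ) : Head T N

/-- Finite η-long normal forms `λ x₁ ⋯ xₖ . h s₁ ⋯ sₘ`, as trees. The list `xs` holds the types of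
the bound variables (`[]` for a dummy lambda). Each constructor stands for two nodes of the
computation tree: the `λ`-node and its unique child, which carries the head. -/
inductive CTree (T : Type u) (N : Type v) : Type (max u v)
  | lam (xs : List Ty) (h : Head T N) (children : List (CTree T N)) : CTree T N

/-- If `B = B₁ → ⋯ → Bₖ → o`, then `etaArgs B j` lists the η-long normal forms of fresh variables
of types `B₁, …, Bₖ` which occupy the indices `j, j + 1, …` of the `λ`-node just above. -/
def etaArgs (T : Type u) (N : Type v) : Ty → ℕ → List (CTree T N)
  | Ty.o, _ => []
  | Ty.arr A B, j =>
      CTree.lam A.args (Head.var A 1 j) (etaArgs T N A 0) :: etaArgs T N B (j + 1)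

section Eta

variable {T : Type u} {N : Type v} {ar : T → ℕ} {ty : N → Ty} {Z : List Ty}

/-- Head and arguments of the body of the η-long normal form of `e`, followed by the already
converted arguments `acc`. The number `t` counts the `λ`-nodes strictly between this body and
the `λ`-node that binds the parameters. An operand `a : A` becomes the η-long
`λ y₁ ⋯ yₖ . a y₁ ⋯ yₖ`. -/
def spine : {A : Ty} → ATerm ar ty Z A → ℕ → List (CTree T N) → Head T N × List (CTree T N)
  | _, ATerm.term f, _, acc => (Head.term f, acc)
  | _, ATerm.nonterm F, _, acc => (Head.nonterm F, acc)
  | _, ATerm.param i, t, acc => (Head.var (Z.get i) t i, acc)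
  | _, @ATerm.app _ _ _ _ _ A _ e a, t, acc =>
      spine e t
        (CTree.lam A.args (spine a (t + 1) (etaArgs T N A 0)).1
          (spine a (t + 1) (etaArgs T N A 0)).2 :: acc)

end Eta

/-- The subtree rooted at the `λ`-node reached from the root by choosing successively the
(0-based) operands in the given list. -/
def CTree.sub {T : Type u} {N : Type v} : List ℕ → CTree T N → Option (CTree T N)
  | [], t => some t
  | i :: p, CTree.lam _ _ cs => cs[i]?.bind (CTree.sub p)

namespace Scheme

variable (G : Scheme.{u, v})

/-- The (finite) computation tree of `Λ(F) = λ z₁ ⋯ zₘ . rhs F`, non-terminals not unfolded. -/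
def ruleTree (F : G.NonTerm) : CTree G.Terminal G.NonTerm :=
  CTree.lam (G.ty F).args (spine (G.rhs F) 0 []).1 (spine (G.rhs F) 0 []).2

/-! ## The computation graph -/

/-- Nodes of the computation graph: the nodes of the trees of all the rules. A node is either the
`λ`-node at the given address or the unique child of that `λ`-node. -/
@[ext]
structure Node where
  nt : G.NonTerm
  addr : List ℕ
  isLam : Bool
  valid : ((G.ruleTree nt).sub addr).isSome

/-- Labels of nodes: lambdas, application nodes `@` (whose operator is the non-terminal `F`),
terminals and variables (data as in `Head.var`). -/
inductive Label
  | lam (xs : List Ty)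
  | app (F : G.NonTerm)
  | term (f : G.Terminal)
  | var (A : Ty) (d i : ℕ)

variable {G}

/-- The label of a node. -/
def Node.label (w : G.Node) : G.Label :=
  match ((G.ruleTree w.nt).sub w.addr).get w.valid with
  | CTree.lam xs h _ =>
    if w.isLam then Label.lam xs
    else match h with
      | Head.term f => Label.term f
      | Head.nonterm F => Label.app F
      | Head.var A d i => Label.var A d i

/-- The order of a node: `1 + max ord xᵢ` for `λ x₁ ⋯ xₖ` with `k > 0`, and `0` for a dummy
lambda; the order of its type for a variable or a terminal (`0` for the other nodes). -/
def Node.order (w : G.Node) : ℕ :=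
  match w.label with
  | Label.lam xs => (xs.map fun A => A.order + 1).foldr max 0
  | Label.app _ => 0
  | Label.term f => (Ty.ofArity (G.arity f)).order
  | Label.var A _ _ => A.order

variable (G) in
/-- The root `λ`-node of the tree of the rule of `F`. -/
def root (F : G.NonTerm) : G.Node where
  nt := F
  addr := []
  isLam := true
  valid := rfl

/-- `Edge w i w'`: the node `w'` is `E_i(w)`, the `i`-th child of `w`. The unique child of a
`λ`-node has index `1`; the operands of the other nodes have indices `1, 2, …`; and an `@`-node with
operator `F` has as child number `0` the (prime) root `λ`-node of the rule of `F`. -/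
inductive Edge : G.Node → ℕ → G.Node → Prop
  | body (w w' : G.Node) : w.isLam = true → w'.isLam = false → w'.nt = w.nt →
      w'.addr = w.addr → Edge w 1 w'
  | operator (w : G.Node) (F : G.NonTerm) : w.label = Label.app F → Edge w 0 (G.root F)
  | operand (w w' : G.Node) (i : ℕ) : w.isLam = false → w'.isLam = true → w'.nt = w.nt →
      w'.addr = w.addr ++ [i] → Edge w (i + 1) w'

/-! ## The computation tree of the scheme, and incremental binding -/

/-- The computation tree of `G` is the unfolding of the computation graph from the root of the
start symbol: its nodes are the finite paths from that root. A path is listed backwards: the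
current node comes first and the root comes last. -/
inductive IsPath : List G.Node → Prop
  | root : IsPath [G.root G.start]
  | step (w w' : G.Node) (i : ℕ) (π : List G.Node) :
      IsPath (w :: π) → Edge w i w' → IsPath (w' :: w :: π)

/-- The finite trees obtained by pruning branches of the computation tree: finite sets of nodes of
the computation tree that contain the parent of each of their nodes. -/
structure IsFinitePruning (P : Set (List G.Node)) : Prop where
  finite : P.Finite
  isPath : ∀ π ∈ P, IsPath π
  parent : ∀ w w' π, w' :: w :: π ∈ P → w :: π ∈ P

/-- A variable node with datum `d` occurs `2 * d + 1` levels below its binder, as `λ`-nodes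
and other nodes alternate. -/
def span (d : ℕ) : ℕ := 2 * d + 1

/-- A tree is incrementally-bound if each variable node `x` is bound by the first `λ`-node, on the
path from `x` to the root, whose order is greater than `ord x`. -/
def TreeIncrementallyBound (P : Set (List G.Node)) : Prop :=
  ∀ (w : G.Node) (π : List G.Node) (A : Ty) (d i : ℕ), w :: π ∈ P → w.label = Label.var A d i →
    (w :: π).findIdx? (fun y => y.isLam && decide (A.order < y.order)) = some (span d)

variable (G) in
/-- A scheme is incrementally-bound if all finite prunings of its computation tree are. -/
def IncrementallyBound : Prop :=
  ∀ P : Set (List G.Node), IsFinitePruning P → TreeIncrementallyBound P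

end Scheme

/-! ## Higher-order stacks with links -/

/-- `HStack α m` is the type of stacks of order `m + 1` over `α`, listed from top to bottom.
A `1`-stack is a sequence of symbols; a stack of order `m + 2` is a non-empty sequence of stacks of
order `m + 1`, given by its top element and the list of the other ones. -/
def HStack (α : Type u) : ℕ → Type u
  | 0 => List α
  | m + 1 => HStack α m × List (HStack α m)

/-- A stack symbol `a^(j,k)` with a link of order `j` and height `k`. -/
@[ext]
structure Linked (α : Type u) where
  sym : α
  linkOrder : ℕ
  linkHeight : ℕ

namespace HStack

variable {α : Type u}

/-- The empty stack of order `m + 1`. -/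
def bot : (m : ℕ) → HStack α m
  | 0 => ([] : List α)
  | m + 1 => (bot m, [])

/-- `top₂`: the top `1`-stack, with links unchanged. For a `1`-stack this is the stack itself. -/
def top2 : {m : ℕ} → HStack α m → List α
  | 0, s => s
  | _ + 1, s => top2 s.1

/-- Replace the top `1`-stack. -/
def setTop2 : {m : ℕ} → HStack α m → List α → HStack α m
  | 0, _, x => x
  | _ + 1, s, x => (setTop2 s.1 x, s.2)

/-- `top₁`: the top symbol, if any. -/
def top1 {m : ℕ} (s : HStack α m) : Option α := s.top2.head?

/-- `push₁ a`. -/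
def push1 {m : ℕ} (a : α) (s : HStack α m) : HStack α m := s.setTop2 (a :: s.top2)

/-- `pop_j`, for `1 ≤ j ≤ ord s`; undefined if there is nothing to remove, or if nothing would
remain at an order above `1`. -/
def pop (j : ℕ) : {m : ℕ} → HStack α m → Option (HStack α m)
  | 0, s =>
    if j = 1 then
      match (s : List α) with
      | [] => none
      | _ :: x => some (x : List α)
    else none
  | m + 1, s =>
    if j = m + 2 then
      match s.2 with
      | [] => none
      | t :: r => some (t, r)
    else (pop j s.1).map fun t => (t, s.2)

/-- `pop_j^k`, the `k`-fold iteration of `pop_j`. -/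
def popIter {m : ℕ} (j : ℕ) : ℕ → HStack α m → Option (HStack α m)
  | 0, s => some s
  | k + 1, s => (s.pop j).bind (popIter j k)

/-- `collapse s = pop_j^k s`, where `top₁ s = a^(j,k)`. -/
def collapse {m : ℕ} (s : HStack (Linked α) m) : Option (HStack (Linked α) m) :=
  s.top1.bind fun a => s.popIter a.linkOrder a.linkHeight

/-- `s^⟨j⟩`: each link `(j, k)` of order `j` in `s` becomes `(j, k + 1)`. -/
def raise (j : ℕ) : {m : ℕ} → HStack (Linked α) m → HStack (Linked α) m
  | 0, s => List.map (fun a : Linked α =>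
      if a.linkOrder = j then { a with linkHeight := a.linkHeight + 1 } else a) s
  | _ + 1, s => (raise j s.1, s.2.map (raise j))

/-- `push_j`, for `2 ≤ j ≤ ord s`: duplicates the top stack of order `j - 1`, and applies `⟨j⟩` to
the new copy. -/
def dup (j : ℕ) : {m : ℕ} → HStack (Linked α) m → Option (HStack (Linked α) m)
  | 0, _ => none
  | m + 1, s =>
    if j = m + 2 then some (s.1.raise j, s.1 :: s.2)
    else (dup j s.1).map fun t => (t, s.2)

end HStack

namespace Scheme

variable {G : Scheme.{u, v}}

/-! ## The automaton `CPDA(G)` -/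

/-- The links `(j, k)` allowed in an automaton of order `n`. -/
def IsLink (n j k : ℕ) : Prop := 1 ≤ j ∧ j ≤ n ∧ 1 ≤ k ∧ (j = 1 → k = 1)

/-- The steps `c → c'` of `CPDA(G)`, with `n = G.order`; configurations are stacks of order `n` over
the nodes of the computation graph. Where the automaton leaves the link of the pushed
symbol undetermined, all links are allowed. -/
inductive Step {m : ℕ} : HStack (Linked G.Node) m → HStack (Linked G.Node) m → Prop
  /-- Application: `push₁^{E₀(w),1}`. -/
  | app (c : HStack (Linked G.Node) m) (a : Linked G.Node) (F : G.NonTerm) (w' : G.Node) :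
      c.top1 = some a → a.sym.label = Label.app F → Edge a.sym 0 w' →
      Step c (c.push1 ⟨w', 1, 1⟩)
  /-- Terminal: `push₁^{Eᵢ(w)}`, for a direction `i ≥ 1` chosen by the environment. -/
  | term (c : HStack (Linked G.Node) m) (a : Linked G.Node) (f : G.Terminal) (i : ℕ)
      (w' : G.Node) (j k : ℕ) :
      c.top1 = some a → a.sym.label = Label.term f → 1 ≤ i → i ≤ G.arity f → Edge a.sym i w' →
      IsLink G.order j k → Step c (c.push1 ⟨w', j, k⟩)
  /-- Lambda: `push₁^{E₁(w)}`. -/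
  | lam (c : HStack (Linked G.Node) m) (a : Linked G.Node) (xs : List Ty) (w' : G.Node)
      (j k : ℕ) :
      c.top1 = some a → a.sym.label = Label.lam xs → Edge a.sym 1 w' →
      IsLink G.order j k → Step c (c.push1 ⟨w', j, k⟩)
  /-- Variable of order `l ≥ 1`, of span `p` and (1-based) index `i + 1`:
  `push_{n-l+1} ; pop₁^p ; collapse ; push₁^{E_{i+1}(top₁), n-l+1}`. -/
  | var_pos (c c₁ c₂ t : HStack (Linked G.Node) m) (a b : Linked G.Node) (A : Ty) (d i : ℕ)
      (w' : G.Node) :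
      c.top1 = some a → a.sym.label = Label.var A d i → 1 ≤ A.order →
      c.dup (G.order - A.order + 1) = some c₁ →
      c₁.popIter 1 (span d) = some c₂ →
      c₂.collapse = some t →
      t.top1 = some b → Edge b.sym (i + 1) w' →
      Step c (t.push1 ⟨w', G.order - A.order + 1, 1⟩)
  /-- Variable of ground type, of span `p` and (1-based) index `i + 1`:
  `pop₁^p ; collapse ; push₁^{E_{i+1}(top₁)}`. -/
  | var_zero (c c₂ t : HStack (Linked G.Node) m) (a b : Linked G.Node) (A : Ty) (d i : ℕ)
      (w' : G.Node) (j k : ℕ) :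
      c.top1 = some a → a.sym.label = Label.var A d i → A.order = 0 →
      c.popIter 1 (span d) = some c₂ →
      c₂.collapse = some t →
      t.top1 = some b → Edge b.sym (i + 1) w' →
      IsLink G.order j k → Step c (t.push1 ⟨w', j, k⟩)

/-- `c` is an initial configuration: `push₁ λ ⊥ₙ`, where `λ` is the root of the computation graph
(with an undetermined link). -/
def IsInitial {m : ℕ} (c : HStack (Linked G.Node) m) : Prop :=
  ∃ j k, IsLink G.order j k ∧ c = (HStack.bot m).push1 ⟨G.root G.start, j, k⟩

/-- The `→`-reachable configurations of `CPDA(G)`. -/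
def Reachable {m : ℕ} (c : HStack (Linked G.Node) m) : Prop :=
  ∃ c₀, IsInitial c₀ ∧ Relation.ReflTransGen Step c₀ c

/-! ## Safe stacks -/

variable (G) in
/-- An occurrence of a symbol in a `1`-stack: the symbol, and the part of the stack below it. -/
structure Occ where
  elt : Linked G.Node
  below : List (Linked G.Node)

/-- The incremental order-decomposition of a `1`-stack with respect to `l`, from top to bottom:
take the topmost `λ`-node of order `> l`, and continue below it with its order in place of `l`. -/
def orddec1 : ℕ → List (Linked G.Node) → List G.Occ
  | _, [] => []
  | l, a :: x =>
    if a.sym.isLam = true ∧ l < a.sym.order then ⟨a, x⟩ :: orddec1 a.sym.order x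
    else orddec1 l x

/-- The incremental order-decomposition `⟨η₁, …, η_r⟩` of a higher-order stack with respect to `l`,
with `η₁` the topmost node. -/
def orddec {m : ℕ} (l : ℕ) (s : HStack (Linked G.Node) m) : List G.Occ := orddec1 l s.top2

/-- The prefix of `s` at an occurrence in its top `1`-stack. -/
def prefixAt {m : ℕ} (s : HStack (Linked G.Node) m) (x : G.Occ) : HStack (Linked G.Node) m :=
  s.setTop2 (x.elt :: x.below)

/-- The level required after collapsing at the node number `q` (0-based, from the top) of the
decomposition `D`: it is `l` at the topmost node, and the order of the preceding node otherwise. -/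
def levelAt (l : ℕ) (D : List G.Occ) : ℕ → ℕ
  | 0 => l
  | q + 1 => (D[q]?.map fun x => x.elt.sym.order).getD l

/-- `l`-safe stacks (`s` has order `m + 1`, and `n = G.order`): `s` is not the empty stack, the links
in `orddec l s` have height `1`, and if `η` is a node of `orddec l s` with
`n - ord η + 1 ≤ ord s` then the collapse of the prefix of `s` at `η` is defined, and is `l`-safe if
`η` is the topmost node of the decomposition and `ord η'`-safe if `η'` is the node that
precedes `η` (just above it) in the decomposition. -/
inductive LSafe : {m : ℕ} → ℕ → HStack (Linked G.Node) m → Prop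
  | intro {m : ℕ} (l : ℕ) (s : HStack (Linked G.Node) m)
      (nonempty : s ≠ HStack.bot m)
      (height : ∀ x ∈ orddec l s, x.elt.linkHeight = 1)
      (defined : ∀ (q : ℕ) (x : G.Occ), (orddec l s)[q]? = some x →
        G.order + 1 ≤ (m + 1) + x.elt.sym.order → (prefixAt s x).collapse.isSome)
      (collapse : ∀ (q : ℕ) (x : G.Occ) (t : HStack (Linked G.Node) m),
        (orddec l s)[q]? = some x → G.order + 1 ≤ (m + 1) + x.elt.sym.order →
        (prefixAt s x).collapse = some t → LSafe (levelAt l (orddec l s) q) t) :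
      LSafe l s

/-- Safe stacks are the `0`-safe ones. -/
def IsSafe {m : ℕ} (s : HStack (Linked G.Node) m) : Prop := LSafe 0 s

end Scheme

end Hors

/-! The proof is an induction along the run with an invariant, `StrongSafe 0`, that implies safety.
Write n for the order of the scheme. Beyond safety, the invariant says that the top order-1 stack is
a path of the computation tree, that the link of a node λ of the decomposition has order at most n -
ord λ + 1, and that collapsing at λ reaches a node whose operands have the types of the variables
bound by λ (`Provides`).

The decisive case is a variable of order l ≥ 1. Nodes of the l-decomposition have order above l, so
their links have order below n - l + 1 and push_{n-l+1} raises none of them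
(`StrongSafe.topRaised`). Incremental binding makes the binder the topmost node of this
decomposition, so the collapse there is defined and l-safe (`StrongSafe.return_binder`). By typing,
the λ-node pushed next has order l. Its link leads back to the configuration before the step,
because only pops of order below n - l + 1 followed the duplication. That configuration is 0-safe
and the stack under the new node is l-safe, which is exactly what 0-safety requires
(`StrongSafe.push_of_lt`).

For a variable of order 0 the pushed λ-node has order 0 and stays outside the decomposition. For an
@-node the link (1,1) undoes the push, and safety at level 0 gives safety at every higher level
(`StrongSafe.mono`). -/

namespace Hors

/-! ## Typing of computation trees -/

namespace Ty

theorem order_eq_foldr : ∀ A : Ty, (A.args.map fun B => B.order + 1).foldr max 0 = A.order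
  | o => rfl
  | arr A B => by simp [args, order, order_eq_foldr B]

theorem args_ofArity : ∀ k : ℕ, (ofArity k).args = List.replicate k o
  | 0 => rfl
  | k + 1 => by simp [ofArity, args, args_ofArity k, List.replicate_succ]

end Ty

section Typing

variable {T : Type u} {N : Type v} (ar : T → ℕ) (ty : N → Ty)

/-- The type of a head. -/
def Head.type : Head T N → Ty
  | term f => Ty.ofArity (ar f)
  | nonterm F => ty F
  | var A _ _ => A

/-- A head is scoped in an environment, the list of the variable lists of the enclosing lambdas,
if it is a constant or a variable which the environment declares with the same type. -/
def Head.Scoped (env : List (List Ty)) : Head T N → Prop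
  | var A d i => ∃ xs, env[d]? = some xs ∧ xs[i]? = some A
  | _ => True

/-- The types of the variables bound by the root. -/
def CTree.binders : CTree T N → List Ty
  | lam xs _ _ => xs

/-- Well-typed η-long trees in an environment. -/
inductive CTree.WellTyped : List (List Ty) → CTree T N → Prop
  | lam (env : List (List Ty)) (xs : List Ty) (h : Head T N) (cs : List (CTree T N)) :
      h.Scoped (xs :: env) →
      cs.map CTree.binders = (h.type ar ty).args.map Ty.args →
      (∀ c ∈ cs, CTree.WellTyped (xs :: env) c) → CTree.WellTyped env (CTree.lam xs h cs)

/-- Each step consumes one argument type and one index, so `ys.drop j = B.args` is the invariant of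
the recursion: the variables from `j` on are those still to be expanded. -/
theorem etaArgs_wellTyped (B : Ty) : ∀ (j : ℕ) (ys : List Ty) (env : List (List Ty)),
    ys.drop j = B.args →
    (etaArgs T N B j).map CTree.binders = B.args.map Ty.args ∧
      ∀ c ∈ etaArgs T N B j, c.WellTyped ar ty (ys :: env) := by
  induction B with
  | o => intro j ys env _; simp [etaArgs, Ty.args]
  | arr A B ihA ihB =>
    intro j ys env h
    have hj : ys[j]? = some A := by
      have := congrArg List.head? h
      simpa [Ty.args] using this
    have hd : ys.drop (j + 1) = B.args := by
      have := congrArg List.tail h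
      simpa [Ty.args] using this
    obtain ⟨h1, h2⟩ := ihB (j + 1) ys env hd
    obtain ⟨h3, h4⟩ := ihA 0 A.args (ys :: env) rfl
    refine ⟨by simp [etaArgs, Ty.args, CTree.binders, h1], ?_⟩
    intro c hc
    rcases List.mem_cons.1 hc with rfl | hc
    · exact CTree.WellTyped.lam _ _ _ _ ⟨ys, rfl, hj⟩ h3 h4
    · exact h2 c hc

variable {ar ty}

/-- The accumulator holds operands for all arguments of the current type; an application adds the
operand for the additional argument of its function part, so at the head the operands match the type
of the head. -/
theorem spine_wellTyped {Z : List Ty} {A : Ty} (e : ATerm ar ty Z A) :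
    ∀ (t : ℕ) (acc : List (CTree T N)) (env : List (List Ty)), env[t]? = some Z →
      acc.map CTree.binders = A.args.map Ty.args → (∀ c ∈ acc, c.WellTyped ar ty env) →
      (spine e t acc).1.Scoped env ∧
      (spine e t acc).2.map CTree.binders = ((spine e t acc).1.type ar ty).args.map Ty.args ∧
      ∀ c ∈ (spine e t acc).2, c.WellTyped ar ty env := by
  induction e with
  | term f => intro t acc env _ h1 h2; exact ⟨trivial, h1, h2⟩
  | nonterm F => intro t acc env _ h1 h2; exact ⟨trivial, h1, h2⟩
  | param i => intro t acc env hZ h1 h2; exact ⟨⟨Z, hZ, by simp⟩, h1, h2⟩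
  | @app A B e a ihe iha =>
    intro t acc env hZ h1 h2
    obtain ⟨e1, e2⟩ := etaArgs_wellTyped ar ty A 0 A.args env rfl
    obtain ⟨a1, a2, a3⟩ := iha (t + 1) (etaArgs T N A 0) (A.args :: env) (by simpa using hZ) e1 e2
    refine ihe t _ env hZ (by simp [Ty.args, CTree.binders, h1]) ?_
    intro c hc
    rcases List.mem_cons.1 hc with rfl | hc
    · exact CTree.WellTyped.lam _ _ _ _ a1 a2 a3
    · exact h2 c hc

end Typing

/-! ### Subtrees and labels of the nodes of the computation graph. -/

theorem CTree.sub_append_singleton {T : Type u} {N : Type v} (p : List ℕ) (i : ℕ) :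
    ∀ t : CTree T N, t.sub (p ++ [i]) = (t.sub p).bind (CTree.sub [i]) := by
  induction p with
  | nil => intro t; rfl
  | cons k p ih =>
    rintro ⟨xs, h, cs⟩
    simp only [List.cons_append, CTree.sub]
    cases cs[k]? <;> simp [ih]

namespace Scheme

variable {G : Scheme.{u, v}}

theorem ruleTree_wellTyped (F : G.NonTerm) :
    (G.ruleTree F).WellTyped G.arity G.ty [] := by
  obtain ⟨h1, h2, h3⟩ := spine_wellTyped (G.rhs F) 0 [] [(G.ty F).args] rfl rfl (by simp)
  exact CTree.WellTyped.lam _ _ _ _ h1 h2 h3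

/-- The subtree of the tree of its rule that a node belongs to the root of. -/
def Node.tree (w : G.Node) : CTree G.Terminal G.NonTerm :=
  ((G.ruleTree w.nt).sub w.addr).get w.valid

theorem Node.sub_addr (w : G.Node) : (G.ruleTree w.nt).sub w.addr = some w.tree :=
  (Option.some_get w.valid).symm

theorem Node.label_of_isLam {w : G.Node} (h : w.isLam = true) :
    w.label = Label.lam w.tree.binders := by
  unfold Node.label Node.tree
  split
  next heq => simp [heq, h, CTree.binders]

/-- The label of a head. -/
def headLabel : Head G.Terminal G.NonTerm → G.Label
  | Head.term f => Label.term f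
  | Head.nonterm F => Label.app F
  | Head.var A d i => Label.var A d i

theorem Node.label_of_not_isLam {w : G.Node} (h : w.isLam = false) {xs hd cs}
    (ht : w.tree = CTree.lam xs hd cs) : w.label = headLabel hd := by
  have ht' : ((G.ruleTree w.nt).sub w.addr).get w.valid = CTree.lam xs hd cs := ht
  unfold Node.label
  rw [ht']
  cases hd <;> simp [h, headLabel]

theorem Node.isLam_iff {w : G.Node} : w.isLam = true ↔ ∃ xs, w.label = Label.lam xs := by
  refine ⟨fun h => ⟨_, w.label_of_isLam h⟩, ?_⟩
  rintro ⟨xs, h⟩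
  by_contra hl
  rw [Bool.not_eq_true] at hl
  rcases ht : w.tree with ⟨ys, hd, cs⟩
  rw [Node.label_of_not_isLam hl ht] at h
  cases hd <;> simp [headLabel] at h

theorem Node.tree_of_addr_append {w w' : G.Node} {i : ℕ} (hnt : w'.nt = w.nt)
    (ha : w'.addr = w.addr ++ [i]) {xs hd cs} (ht : w.tree = CTree.lam xs hd cs) :
    cs[i]? = some w'.tree := by
  have h := w'.sub_addr
  rw [hnt, ha, CTree.sub_append_singleton, w.sub_addr, ht] at h
  simpa [CTree.sub, Option.bind_eq_some_iff] using h

theorem Node.tree_of_addr_eq {w w' : G.Node} (hnt : w'.nt = w.nt) (ha : w'.addr = w.addr) :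
    w'.tree = w.tree := by
  have h := w'.sub_addr
  rw [hnt, ha, w.sub_addr] at h
  exact (Option.some.inj h).symm

/-! ## Paths of the computation tree -/

/-- On a path, the environment of the current node consists of the variables of the `λ`-nodes
which occur at every second position. -/
theorem IsPath.exists_env {π : List G.Node} (hπ : IsPath π) :
    ∃ w ρ, π = w :: ρ ∧ ∃ env, w.tree.WellTyped G.arity G.ty env ∧
      if w.isLam then
        ∀ (d : ℕ) (ys : List Ty), env[d]? = some ys →
          ∃ u, π[2 * d + 2]? = some u ∧ u.label = Label.lam ys
      else
        ∀ (d : ℕ) (ys : List Ty), (w.tree.binders :: env)[d]? = some ys →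
          ∃ u, π[2 * d + 1]? = some u ∧ u.label = Label.lam ys := by
  induction hπ with
  | root =>
    refine ⟨_, _, rfl, [], ruleTree_wellTyped _, ?_⟩
    simp [Scheme.root]
  | step w w' i π _ hE ih =>
    obtain ⟨_, _, heq, env, hwt, hpos⟩ := ih
    obtain ⟨rfl, rfl⟩ := List.cons.inj heq
    refine ⟨_, _, rfl, ?_⟩
    cases hE with
    | body _ hl hl' hnt ha =>
      rw [if_pos hl] at hpos
      have ht := Node.tree_of_addr_eq hnt ha
      refine ⟨env, ht ▸ hwt, ?_⟩
      rw [if_neg (by simp [hl'])]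
      rintro (_ | d) ys hd
      · refine ⟨w, by simp, ?_⟩
        rw [ht] at hd
        simp only [List.getElem?_cons_zero, Option.some.injEq] at hd
        rw [← hd]
        exact w.label_of_isLam hl
      · exact hpos d ys (by simpa using hd)
    | operator F hF =>
      -- The tree of a rule is closed, so a prime λ-node starts with an empty environment.
      refine ⟨[], ruleTree_wellTyped F, ?_⟩
      simp [Scheme.root]
    | operand _ i hl hl' hnt ha =>
      rw [if_neg (by simp [hl])] at hpos
      rcases ht : w.tree with ⟨xs, hd, cs⟩
      rw [ht] at hwt
      cases hwt with
      | lam _ _ _ _ h1 h2 h3 =>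
        refine ⟨xs :: env, h3 _ (List.mem_of_getElem? (Node.tree_of_addr_append hnt ha ht)), ?_⟩
        rw [if_pos hl']
        intro d ys hd
        exact hpos d ys (by simpa [ht, CTree.binders] using hd)

/-- Lambda labels of the operands of a node in terms of the type of its head. -/
theorem IsPath.label_operand {w w' : G.Node} {π : List G.Node} (hπ : IsPath (w :: π))
    (hl : w.isLam = false) {xs hd cs} (ht : w.tree = CTree.lam xs hd cs) {i : ℕ}
    (hE : Edge w (i + 1) w') :
    ∃ A, (hd.type G.arity G.ty).args[i]? = some A ∧ w'.label = Label.lam A.args := by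
  obtain ⟨_, _, heq, env, hwt, _⟩ := hπ.exists_env
  obtain ⟨rfl, rfl⟩ := List.cons.inj heq
  cases hE with
  | body _ h => simp [h] at hl
  | operand _ _ _ hl' hnt ha =>
    rw [ht] at hwt
    cases hwt with
    | lam _ _ _ _ h1 h2 h3 =>
      have hc := Node.tree_of_addr_append hnt ha ht
      have h := congrArg (fun L => L[i]?) h2
      simp only [List.getElem?_map, hc, Option.map_some] at h
      obtain ⟨A, hA, hA'⟩ := Option.map_eq_some_iff.1 h.symm
      exact ⟨A, hA, by rw [Node.label_of_isLam hl', hA']⟩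

theorem Node.not_isLam_of_label {w : G.Node} {L : G.Label} (h : w.label = L)
    (hL : ∀ xs, L ≠ Label.lam xs) : w.isLam = false := by
  by_contra hw
  obtain ⟨xs, hx⟩ := Node.isLam_iff.1 (by simpa using hw)
  exact hL xs (h ▸ hx)

theorem IsPath.label_operand_app {w w' : G.Node} {π : List G.Node} (hπ : IsPath (w :: π))
    {F : G.NonTerm} (h : w.label = Label.app F) {i : ℕ} (hE : Edge w (i + 1) w') :
    ∃ A, (G.ty F).args[i]? = some A ∧ w'.label = Label.lam A.args := by
  have hl := Node.not_isLam_of_label h (by simp)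
  rcases ht : w.tree with ⟨xs, hd, cs⟩
  have hh := Node.label_of_not_isLam hl ht
  obtain ⟨A, hA⟩ := hπ.label_operand hl ht hE
  cases hd <;> simp_all [headLabel, Head.type]

theorem IsPath.label_operand_term {w w' : G.Node} {π : List G.Node} (hπ : IsPath (w :: π))
    {f : G.Terminal} (h : w.label = Label.term f) {i : ℕ} (hE : Edge w (i + 1) w') :
    w'.label = Label.lam [] := by
  have hl := Node.not_isLam_of_label h (by simp)
  rcases ht : w.tree with ⟨xs, hd, cs⟩
  have hh := Node.label_of_not_isLam hl ht
  obtain ⟨A, hA, hA'⟩ := hπ.label_operand hl ht hE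
  have hd' : hd = Head.term f := by cases hd <;> simp_all [headLabel]
  subst hd'
  rw [Head.type, Ty.args_ofArity] at hA
  obtain rfl : A = Ty.o := List.eq_of_mem_replicate (List.mem_of_getElem? hA)
  exact hA'

theorem IsPath.label_operand_var {w w' : G.Node} {π : List G.Node} (hπ : IsPath (w :: π))
    {B : Ty} {d k : ℕ} (h : w.label = Label.var B d k) {i : ℕ} (hE : Edge w (i + 1) w') :
    ∃ A, B.args[i]? = some A ∧ w'.label = Label.lam A.args := by
  have hl := Node.not_isLam_of_label h (by simp)
  rcases ht : w.tree with ⟨xs, hd, cs⟩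
  have hh := Node.label_of_not_isLam hl ht
  obtain ⟨A, hA⟩ := hπ.label_operand hl ht hE
  cases hd <;> simp_all [headLabel, Head.type]

/-- The binder of a variable declares it with its type. -/
theorem IsPath.label_binder {w : G.Node} {π : List G.Node} (hπ : IsPath (w :: π))
    {A : Ty} {d i : ℕ} (h : w.label = Label.var A d i) :
    ∃ u xs, (w :: π)[span d]? = some u ∧ u.label = Label.lam xs ∧ xs[i]? = some A := by
  have hl := Node.not_isLam_of_label h (by simp)
  obtain ⟨_, _, heq, env, hwt, hpos⟩ := hπ.exists_env
  obtain ⟨rfl, rfl⟩ := List.cons.inj heq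
  rcases ht : w.tree with ⟨xs, hd, cs⟩
  have hh := Node.label_of_not_isLam hl ht
  obtain rfl : hd = Head.var A d i := by cases hd <;> simp_all [headLabel]
  rw [if_neg (by simp [hl])] at hpos
  rw [ht] at hwt hpos
  cases hwt with
  | lam _ _ _ _ h1 h2 h3 =>
    obtain ⟨ys, hy, hi⟩ := h1
    obtain ⟨u, hu, hu'⟩ := hpos d ys hy
    exact ⟨u, ys, hu, hu', hi⟩

theorem IsPath.of_suffix {π ρ : List G.Node} (hπ : IsPath π) (hρ : ρ ≠ []) (h : ρ <:+ π) :
    IsPath ρ := by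
  induction hπ with
  | root =>
    rcases List.suffix_cons_iff.1 h with rfl | h
    · exact IsPath.root
    · exact absurd (List.suffix_nil.1 h) hρ
  | step w w' i π hp hE ih =>
    rcases List.suffix_cons_iff.1 h with rfl | h
    · exact IsPath.step _ _ _ _ hp hE
    · exact ih h

/-- A single branch, that is, the set of non-empty suffixes of a path, is already a finite pruning.
-/
theorem IncrementallyBound.findIdx? (hG : G.IncrementallyBound) {w : G.Node} {π : List G.Node}
    (hπ : IsPath (w :: π)) {A : Ty} {d i : ℕ} (h : w.label = Label.var A d i) :
    (w :: π).findIdx? (fun y => y.isLam && decide (A.order < y.order)) = some (span d) := by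
  refine hG {ρ | ρ ≠ [] ∧ ρ <:+ w :: π} ⟨?_, ?_, ?_⟩ w π A d i ⟨by simp, List.suffix_rfl⟩ h
  · refine (List.finite_toSet (w :: π).tails).subset ?_
    rintro ρ ⟨_, hρ⟩
    exact (List.mem_tails _ _).2 hρ
  · rintro ρ ⟨h1, h2⟩
    exact hπ.of_suffix h1 h2
  · rintro a b ρ ⟨_, h2⟩
    exact ⟨by simp, (List.suffix_cons b _).trans h2⟩

/-- Turns typing into orders: the operand substituted for a variable has the order of that variable.
-/
theorem Node.order_of_label_lam {w : G.Node} {A : Ty} (h : w.label = Label.lam A.args) :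
    w.order = A.order := by
  unfold Node.order
  rw [h]
  exact A.order_eq_foldr

end Scheme

/-! ## Stack operations -/

namespace HStack

variable {α : Type u}

@[simp] theorem top2_bot : ∀ m : ℕ, (bot m : HStack α m).top2 = []
  | 0 => rfl
  | m + 1 => top2_bot m

@[simp] theorem top2_setTop2 : ∀ {m : ℕ} (s : HStack α m) (x : List α), (s.setTop2 x).top2 = x
  | 0, _, _ => rfl
  | _ + 1, s, x => top2_setTop2 s.1 x

@[simp] theorem setTop2_setTop2 : ∀ {m : ℕ} (s : HStack α m) (x y : List α),
    (s.setTop2 x).setTop2 y = s.setTop2 y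
  | 0, _, _, _ => rfl
  | _ + 1, s, x, y => Prod.ext (setTop2_setTop2 s.1 x y) rfl

@[simp] theorem setTop2_top2 : ∀ {m : ℕ} (s : HStack α m), s.setTop2 s.top2 = s
  | 0, _ => rfl
  | _ + 1, s => Prod.ext (setTop2_top2 s.1) rfl

theorem pop_succ_of_ne {i m : ℕ} (hi : i ≠ m + 2) {s t : HStack α (m + 1)} :
    s.pop i = some t ↔ ∃ r, pop i s.1 = some r ∧ (r, s.2) = t := by
  rw [pop, if_neg hi]
  exact Option.map_eq_some_iff

theorem pop_one : ∀ {m : ℕ} (s : HStack α m) {t : HStack α m}, s.pop 1 = some t ↔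
    ∃ a x, s.top2 = a :: x ∧ t = s.setTop2 x
  | 0, s, t => by
    change List α at s t
    cases s with
    | nil => simp [pop, top2]
    | cons a x =>
      simp [pop, top2, setTop2]
      exact ⟨fun h => (Option.some.inj h).symm, fun h => congrArg some h.symm⟩
  | m + 1, s, t => by
    rw [pop_succ_of_ne (by omega)]
    constructor
    · rintro ⟨r, hr, rfl⟩
      obtain ⟨a, x, h1, rfl⟩ := (pop_one s.1).1 hr
      exact ⟨a, x, h1, rfl⟩
    · rintro ⟨a, x, h1, rfl⟩
      exact ⟨_, (pop_one s.1).2 ⟨a, x, h1, rfl⟩, rfl⟩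

theorem eq_of_popIter_one {m : ℕ} : ∀ (k : ℕ) (s t : HStack α m), s.popIter 1 k = some t →
    t = s.setTop2 (s.top2.drop k)
  | 0, s, t, h => by simpa [popIter, eq_comm] using h
  | k + 1, s, t, h => by
    obtain ⟨r, hr, h⟩ := Option.bind_eq_some_iff.1 h
    obtain ⟨a, x, hx, rfl⟩ := (pop_one s).1 hr
    rw [eq_of_popIter_one k _ t h]
    simp [hx]

theorem pop_setTop2 {j : ℕ} (hj : j ≠ 1) : ∀ {m : ℕ} (s : HStack α m) (x : List α),
    (s.setTop2 x).pop j = s.pop j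
  | 0, s, x => by simp [pop, hj]
  | m + 1, s, x => by
    simp only [pop, setTop2]
    rw [pop_setTop2 hj s.1 x]

theorem pop_le : ∀ {m : ℕ} {j : ℕ} {s t : HStack α m}, s.pop j = some t → j ≤ m + 1
  | 0, j, s, t, h => by
    by_contra hj
    simp [pop, show j ≠ 1 by omega] at h
  | m + 1, j, s, t, h => by
    by_cases hj : j = m + 2
    · omega
    · rw [pop_succ_of_ne hj] at h
      obtain ⟨r, hr, _⟩ := h
      have := pop_le hr
      omega

/-- A pop of lower order changes only the top order-(j-1) stack, which `pop j` discards. -/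
theorem pop_of_pop_lt {i j : ℕ} (hij : i < j) : ∀ {m : ℕ} {s t c : HStack α m},
    s.pop i = some t → s.pop j = some c → t.pop j = some c
  | 0, s, t, c, h1, h2 => by
    have := pop_le h2
    simp [pop, show i ≠ 1 by omega] at h1
  | m + 1, s, t, c, h1, h2 => by
    have hj := pop_le h2
    rw [pop_succ_of_ne (by omega)] at h1
    obtain ⟨r, hr, rfl⟩ := h1
    by_cases hjm : j = m + 2
    · simpa [pop, hjm] using h2
    · obtain ⟨r', hr', rfl⟩ := (pop_succ_of_ne hjm).1 h2
      exact (pop_succ_of_ne hjm).2 ⟨r', pop_of_pop_lt hij hr hr', rfl⟩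

/-! ### Raising of links and duplication. -/

/-- The effect of `raise j` on a symbol. -/
def raiseLink (j : ℕ) (a : Linked α) : Linked α :=
  if a.linkOrder = j then { a with linkHeight := a.linkHeight + 1 } else a

@[simp] theorem raiseLink_sym (j : ℕ) (a : Linked α) : (raiseLink j a).sym = a.sym := by
  unfold raiseLink; split <;> rfl

theorem raiseLink_of_ne {j : ℕ} {a : Linked α} (h : a.linkOrder ≠ j) : raiseLink j a = a :=
  if_neg h

@[simp] theorem map_sym_map_raiseLink (j : ℕ) (x : List (Linked α)) :
    (x.map (raiseLink j)).map Linked.sym = x.map Linked.sym := by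
  simp [Function.comp_def]

theorem top2_raise (j : ℕ) : ∀ {m : ℕ} (s : HStack (Linked α) m),
    (s.raise j).top2 = s.top2.map (raiseLink j)
  | 0, _ => rfl
  | _ + 1, s => top2_raise j s.1

theorem setTop2_raise (j : ℕ) : ∀ {m : ℕ} (s : HStack (Linked α) m) (x : List (Linked α)),
    (s.raise j).setTop2 (x.map (raiseLink j)) = (s.setTop2 x).raise j
  | 0, _, _ => rfl
  | _ + 1, s, x => Prod.ext (setTop2_raise j s.1 x) rfl

theorem pop_raise (i j : ℕ) : ∀ {m : ℕ} (s : HStack (Linked α) m),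
    (s.raise j).pop i = (s.pop i).map (raise j)
  | 0, s => by
    change List (Linked α) at s
    cases s <;> by_cases hi : i = 1 <;> simp only [pop, raise, hi, if_true, if_false] <;> rfl
  | m + 1, (s, r) => by
    by_cases hi : i = m + 2
    · cases r <;> simp only [pop, raise, hi, if_true] <;> rfl
    · simp only [pop, raise, hi, if_false]
      rw [pop_raise i j s]
      cases s.pop i <;> rfl

/-- The top stack of order `j - 1` of the second stack is obtained by raising the links of order
`j` in that of the first one. -/
def TopRaised (j : ℕ) : {m : ℕ} → HStack (Linked α) m → HStack (Linked α) m → Prop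
  | 0, s, s' => s' = s.raise j
  | m + 1, s, s' => if j = m + 2 then s'.1 = s.1.raise j else TopRaised j s.1 s'.1

theorem TopRaised.top2 {j : ℕ} : ∀ {m : ℕ} {s s' : HStack (Linked α) m}, TopRaised j s s' →
    s'.top2 = s.top2.map (raiseLink j)
  | 0, s, s', h => by
    rw [show s' = s.raise j from h]; rfl
  | m + 1, s, s', h => by
    by_cases hj : j = m + 2
    · rw [TopRaised, if_pos hj] at h
      rw [HStack.top2, h, top2_raise, HStack.top2]
    · rw [TopRaised, if_neg hj] at h
      exact h.top2

theorem TopRaised.setTop2 {j : ℕ} : ∀ {m : ℕ} {s s' : HStack (Linked α) m}, TopRaised j s s' →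
    ∀ x : List (Linked α), TopRaised j (s.setTop2 x) (s'.setTop2 (x.map (raiseLink j)))
  | 0, _, _, _, _ => rfl
  | m + 1, s, s', h, x => by
    by_cases hj : j = m + 2
    · rw [TopRaised, if_pos hj] at h ⊢
      rw [HStack.setTop2, h, setTop2_raise, HStack.setTop2]
    · rw [TopRaised, if_neg hj] at h ⊢
      exact h.setTop2 x

/-- For i < j the pop acts inside the top order-(j-1) stack, where the two stacks differ only in
their links. -/
theorem TopRaised.pop {i j : ℕ} (hij : i < j) : ∀ {m : ℕ} {s s' t : HStack (Linked α) m},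
    j ≤ m + 1 → TopRaised j s s' → s.pop i = some t →
      ∃ t', s'.pop i = some t' ∧ TopRaised j t t'
  | 0, s, s', t, hj, h, ht => by
    simp [HStack.pop, show i ≠ 1 by omega] at ht
  | m + 1, s, s', t, hj, h, ht => by
    rw [pop_succ_of_ne (by omega)] at ht
    obtain ⟨r, hr, rfl⟩ := ht
    rw [HStack.pop, if_neg (show i ≠ m + 2 by omega)]
    by_cases hjm : j = m + 2
    · rw [TopRaised, if_pos hjm] at h
      rw [h, pop_raise, hr]
      exact ⟨_, rfl, by simp [TopRaised, hjm]⟩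
    · rw [TopRaised, if_neg hjm] at h
      obtain ⟨r', hr', h'⟩ := h.pop hij (by omega) hr
      rw [hr']
      exact ⟨_, rfl, by simpa [TopRaised, hjm] using h'⟩

theorem dup_spec {j : ℕ} : ∀ {m : ℕ} {s t : HStack (Linked α) m}, s.dup j = some t →
    2 ≤ j ∧ j ≤ m + 1 ∧ TopRaised j s t ∧ t.pop j = some s
  | 0, s, t, h => by simp [dup] at h
  | m + 1, s, t, h => by
    by_cases hj : j = m + 2
    · rw [dup, if_pos hj] at h
      obtain rfl := Option.some.inj h
      exact ⟨by omega, by omega, by simp [TopRaised, hj],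
        by simp only [pop, hj, if_true]; rfl⟩
    · rw [dup, if_neg hj] at h
      obtain ⟨r, hr, rfl⟩ := Option.map_eq_some_iff.1 h
      obtain ⟨h1, h2, h3, h4⟩ := dup_spec hr
      exact ⟨h1, by omega, by simpa [TopRaised, hj] using h3,
        (pop_succ_of_ne hj).2 ⟨_, h4, rfl⟩⟩

theorem top1_eq_some {m : ℕ} {s : HStack α m} {a : α} : s.top1 = some a ↔
    ∃ x, s.top2 = a :: x := by
  unfold top1
  cases s.top2 <;> simp

theorem collapse_of_top2 {m : ℕ} {s : HStack (Linked α) m} {a : Linked α} {x}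
    (h : s.top2 = a :: x) (ha : a.linkHeight = 1) : s.collapse = s.pop a.linkOrder := by
  unfold collapse
  rw [top1_eq_some.2 ⟨x, h⟩, Option.bind_some, ha, popIter]
  simp [popIter]

end HStack

namespace Scheme

variable {G : Scheme.{u, v}} {m : ℕ}

/-! ## Order-decompositions with levels -/

/-- The order-decomposition of a `1`-stack, each occurrence being paired with the order of the
preceding one (with `l` for the topmost one). -/
def leveled : ℕ → List (Linked G.Node) → List (ℕ × G.Occ)
  | _, [] => []
  | l, a :: x =>
    if a.sym.isLam = true ∧ l < a.sym.order then (l, ⟨a, x⟩) :: leveled a.sym.order x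
    else leveled l x

theorem levelAt_mem_leveled : ∀ (X : List (Linked G.Node)) (l q : ℕ) (x : G.Occ),
    (orddec1 l X)[q]? = some x → (levelAt l (orddec1 l X) q, x) ∈ leveled l X
  | [], l, q, x, h => by simp [orddec1] at h
  | a :: X, l, q, x, h => by
    by_cases ha : a.sym.isLam = true ∧ l < a.sym.order
    · rw [orddec1, if_pos ha] at h ⊢
      rw [leveled, if_pos ha]
      cases q with
      | zero =>
        simp only [List.getElem?_cons_zero, Option.some.injEq] at h
        simp [levelAt, h]
      | succ q =>
        simp only [List.getElem?_cons_succ] at h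
        refine List.mem_cons_of_mem _ ?_
        convert levelAt_mem_leveled X a.sym.order q x h using 2
        cases q with
        | zero => simp [levelAt]
        | succ r =>
          -- The two levels have different defaults, `l` and `a.sym.order`; the index is in range,
          -- so neither is used.
          have hr : r < (orddec1 a.sym.order X).length :=
            (Nat.lt_succ_self r).trans (List.getElem?_eq_some_iff.1 h).1
          simp [levelAt, hr]
    · rw [orddec1, if_neg ha] at h ⊢
      rw [leveled, if_neg ha]
      exact levelAt_mem_leveled X l q x h

theorem mem_orddec1 : ∀ (X : List (Linked G.Node)) (l : ℕ) (x : G.Occ),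
    x ∈ orddec1 l X → ∃ k, (k, x) ∈ leveled l X := by
  intro X l x h
  obtain ⟨q, hq⟩ := List.getElem?_of_mem h
  exact ⟨_, levelAt_mem_leveled X l q x hq⟩

theorem lt_of_mem_leveled : ∀ {X : List (Linked G.Node)} {l k : ℕ} {x : G.Occ},
    (k, x) ∈ leveled l X → l ≤ k ∧ k < x.elt.sym.order
  | [], _, _, _, h => by simp [leveled] at h
  | a :: X, l, k, x, h => by
    rw [leveled] at h
    split at h
    next ha =>
      rcases List.mem_cons.1 h with h | h
      · cases h
        exact ⟨le_rfl, ha.2⟩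
      · have := lt_of_mem_leveled h
        exact ⟨ha.2.le.trans this.1, this.2⟩
    next ha => exact lt_of_mem_leveled h

/-- A λ-node kept at the lower level but skipped at the higher one has order at most `l'`, so it
hides no node of order above `l'`. -/
theorem exists_mem_leveled_of_le : ∀ {X : List (Linked G.Node)} {l l' k : ℕ} {x : G.Occ},
    l ≤ l' → (k, x) ∈ leveled l' X → ∃ k₀ ≤ k, (k₀, x) ∈ leveled l X
  | [], _, _, _, _, _, h => by simp [leveled] at h
  | a :: X, l, l', k, x, hl, h => by
    rw [leveled] at h ⊢
    split at h
    next ha =>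
      rw [if_pos ⟨ha.1, hl.trans_lt ha.2⟩]
      rcases List.mem_cons.1 h with h | h
      · cases h
        exact ⟨l, hl, List.mem_cons_self⟩
      · exact ⟨k, le_rfl, List.mem_cons_of_mem _ h⟩
    next ha =>
      split
      next ha' =>
        have hle : a.sym.order ≤ l' := by
          by_contra hlt
          exact ha ⟨ha'.1, not_le.1 hlt⟩
        obtain ⟨k₀, h1, h2⟩ := exists_mem_leveled_of_le hle h
        exact ⟨k₀, h1, List.mem_cons_of_mem _ h2⟩
      next => exact exists_mem_leveled_of_le hl h

theorem exists_mem_leveled_of_map_raiseLink (j : ℕ) :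
    ∀ {X : List (Linked G.Node)} {l k : ℕ} {x : G.Occ},
      (k, x) ∈ leveled l (X.map (HStack.raiseLink j)) → ∃ y : G.Occ, (k, y) ∈ leveled l X ∧
        x = ⟨HStack.raiseLink j y.elt, y.below.map (HStack.raiseLink j)⟩
  | [], _, _, _, h => by simp [leveled] at h
  | a :: X, l, k, x, h => by
    rw [List.map_cons, leveled, HStack.raiseLink_sym] at h
    rw [leveled]
    split at h
    next ha =>
      rw [if_pos ha]
      rcases List.mem_cons.1 h with h | h
      · cases h
        exact ⟨⟨a, X⟩, List.mem_cons_self, rfl⟩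
      · obtain ⟨y, h1, h2⟩ := exists_mem_leveled_of_map_raiseLink j h
        exact ⟨y, List.mem_cons_of_mem _ h1, h2⟩
    next ha =>
      rw [if_neg ha]
      exact exists_mem_leveled_of_map_raiseLink j h

theorem mem_leveled_of_findIdx? : ∀ {X : List (Linked G.Node)} {l p : ℕ},
    (X.map Linked.sym).findIdx? (fun y => y.isLam && decide (l < y.order)) = some p →
      ∃ a Y, X.drop p = a :: Y ∧ (l, (⟨a, Y⟩ : G.Occ)) ∈ leveled l X
  | [], _, _, h => by simp at h
  | a :: X, l, p, h => by
    rw [List.map_cons, List.findIdx?_cons] at h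
    rw [leveled]
    split at h
    next ha =>
      cases h
      rw [if_pos (by simpa using ha)]
      exact ⟨a, X, rfl, List.mem_cons_self⟩
    next ha =>
      rw [if_neg (by simpa using ha)]
      obtain ⟨q, hq, rfl⟩ := Option.map_eq_some_iff.1 h
      obtain ⟨b, Y, h1, h2⟩ := mem_leveled_of_findIdx? hq
      exact ⟨b, Y, by simpa using h1, h2⟩

theorem collapse_prefixAt (s : HStack (Linked G.Node) m) {x : G.Occ}
    (h : x.elt.linkHeight = 1) :
    (prefixAt s x).collapse = (s.setTop2 (x.elt :: x.below)).pop x.elt.linkOrder :=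
  HStack.collapse_of_top2 (HStack.top2_setTop2 _ _) h

/-! ## Strongly safe stacks -/

/-- The operands of `b` have the types of the variables bound by `w`. -/
def Provides (b w : G.Node) : Prop :=
  ∀ xs, w.label = Label.lam xs → ∀ i w', Edge b (i + 1) w' →
    ∃ A, xs[i]? = some A ∧ w'.label = Label.lam A.args

/-- A strengthening of `l`-safety: the top `1`-stack is a path of the computation tree, the
relevant links have bounded order, and the collapse at a node of the decomposition leads to a node
whose operands have the types of the variables bound there. -/
inductive StrongSafe : ℕ → HStack (Linked G.Node) m → Prop
  | intro (l : ℕ) (s : HStack (Linked G.Node) m)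
      (path : IsPath (s.top2.map Linked.sym))
      (link : ∀ k x, (k, x) ∈ leveled l s.top2 →
        x.elt.linkHeight = 1 ∧ x.elt.linkOrder ≤ G.order - x.elt.sym.order + 1)
      (defined : ∀ k x, (k, x) ∈ leveled l s.top2 → ∃ t, (prefixAt s x).collapse = some t)
      (safe : ∀ k x t, (k, x) ∈ leveled l s.top2 → (prefixAt s x).collapse = some t →
        StrongSafe k t)
      (provides : ∀ k x t b, (k, x) ∈ leveled l s.top2 → (prefixAt s x).collapse = some t →
        t.top1 = some b → Provides b.sym x.elt.sym) :
      StrongSafe l s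

theorem StrongSafe.lSafe {l : ℕ} {s : HStack (Linked G.Node) m} (h : StrongSafe l s) :
    LSafe l s := by
  induction h with
  | intro l s path link defined safe provides ih =>
    refine LSafe.intro l s ?_ ?_ ?_ ?_
    · rintro rfl
      rw [HStack.top2_bot] at path
      obtain ⟨_, _, h, _⟩ := path.exists_env
      simp at h
    · intro x hx
      obtain ⟨k, hk⟩ := mem_orddec1 _ _ _ hx
      exact (link k x hk).1
    · intro q x hx _
      obtain ⟨t, ht⟩ := defined _ x (levelAt_mem_leveled _ _ _ _ hx)
      simp [ht]
    · intro q x t hx _ ht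
      exact ih _ x t (levelAt_mem_leveled _ _ _ _ hx) ht

/-- Raising the level shrinks the decomposition, and each remaining node already met its condition
at an equal or lower level; the induction lifts its collapse. -/
theorem StrongSafe.mono {l l' : ℕ} {s : HStack (Linked G.Node) m} (h : StrongSafe l s)
    (hl : l ≤ l') : StrongSafe l' s := by
  induction h generalizing l' with
  | intro l s path link defined safe provides ih =>
    refine StrongSafe.intro l' s path ?_ ?_ ?_ ?_
    · intro k x hx
      obtain ⟨k₀, _, h⟩ := exists_mem_leveled_of_le hl hx
      exact link _ _ h
    · intro k x hx
      obtain ⟨k₀, _, h⟩ := exists_mem_leveled_of_le hl hx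
      exact defined _ _ h
    · intro k x t hx ht
      obtain ⟨k₀, hk, h⟩ := exists_mem_leveled_of_le hl hx
      exact ih _ _ _ h ht hk
    · intro k x t b hx ht hb
      obtain ⟨k₀, _, h⟩ := exists_mem_leveled_of_le hl hx
      exact provides _ _ _ _ h ht hb

/-- Raising the links of order `j ≥ n - l + 1` preserves strong `l`-safety. -/
theorem StrongSafe.topRaised {l j : ℕ} {s s' : HStack (Linked G.Node) m} (h : StrongSafe l s)
    (hj : 2 ≤ j) (hjm : j ≤ m + 1) (hjl : G.order - l + 1 ≤ j) (hs : s.TopRaised j s') :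
    StrongSafe l s' := by
  induction h generalizing s' with
  | intro l s path link defined safe provides ih =>
    have key : ∀ k x, (k, x) ∈ leveled l s'.top2 → ∃ y t t', (k, y) ∈ leveled l s.top2 ∧
        x.elt = y.elt ∧ (prefixAt s y).collapse = some t ∧
        (prefixAt s' x).collapse = some t' ∧ t.TopRaised j t' := by
      intro k x hx
      rw [hs.top2] at hx
      obtain ⟨y, hy, rfl⟩ := exists_mem_leveled_of_map_raiseLink j hx
      obtain ⟨t, ht⟩ := defined k y hy
      obtain ⟨h1, h2⟩ := link k y hy
      have h3 := lt_of_mem_leveled hy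
      -- The order of `y` exceeds `l`, so its link order is below n - l + 1 ≤ j when l < n. When l ≥
      -- n, truncated subtraction makes the link bound 1, and `2 ≤ j` is needed.
      have hlt : y.elt.linkOrder < j := by omega
      have he := HStack.raiseLink_of_ne hlt.ne
      have hp := hs.setTop2 (y.elt :: y.below)
      have ht2 := ht
      rw [collapse_prefixAt s h1] at ht2
      obtain ⟨t', ht', htt⟩ := hp.pop hlt hjm ht2
      refine ⟨y, t, t', hy, he, ht, ?_, htt⟩
      rw [List.map_cons, he] at ht'
      rw [he]
      exact (collapse_prefixAt s' (x := ⟨y.elt, y.below.map (HStack.raiseLink j)⟩) h1).trans ht'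
    refine StrongSafe.intro l s' ?_ ?_ ?_ ?_ ?_
    · rw [hs.top2, HStack.map_sym_map_raiseLink]
      exact path
    · intro k x hx
      obtain ⟨y, t, t', hy, he, ht, ht', htt⟩ := key k x hx
      rw [he]
      exact link k y hy
    · intro k x hx
      obtain ⟨y, t, t', hy, he, ht, ht', htt⟩ := key k x hx
      exact ⟨t', ht'⟩
    · intro k x r hx hr
      obtain ⟨y, t, t', hy, he, ht, ht', htt⟩ := key k x hx
      obtain rfl : t' = r := Option.some.inj (ht'.symm.trans hr)
      -- Levels in the decomposition are at least `l`, so the lower bound on `j` persists.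
      exact ih k y t hy ht (by have := (lt_of_mem_leveled hy).1; omega) htt
    · intro k x r b hx hr hb
      obtain ⟨y, t, t', hy, he, ht, ht', htt⟩ := key k x hx
      obtain rfl : t' = r := Option.some.inj (ht'.symm.trans hr)
      obtain ⟨X, hX⟩ := HStack.top1_eq_some.1 hb
      rw [htt.top2] at hX
      obtain ⟨a, Y, hY, rfl, _⟩ := List.map_eq_cons_iff.1 hX
      rw [he, HStack.raiseLink_sym]
      exact provides k y t a hy ht (HStack.top1_eq_some.2 ⟨Y, hY⟩)

/-! ### Pushing a node onto a strongly safe stack. -/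

theorem StrongSafe.isPath {l : ℕ} {s : HStack (Linked G.Node) m} (h : StrongSafe l s) :
    IsPath (s.top2.map Linked.sym) := by
  cases h; assumption

theorem StrongSafe.isPath_push {l : ℕ} {s : HStack (Linked G.Node) m} (h : StrongSafe l s)
    {a b : Linked G.Node} (hb : s.top1 = some b) {i : ℕ} (hE : Edge b.sym i a.sym) :
    IsPath ((s.push1 a).top2.map Linked.sym) := by
  obtain ⟨x, hx⟩ := HStack.top1_eq_some.1 hb
  have := h.isPath
  rw [hx] at this
  rw [HStack.push1, HStack.top2_setTop2, hx]
  exact IsPath.step _ _ _ _ this hE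

theorem prefixAt_push1 (s : HStack (Linked G.Node) m) (a : Linked G.Node) (x : G.Occ) :
    prefixAt (s.push1 a) x = prefixAt s x :=
  HStack.setTop2_setTop2 _ _ _

/-- Pushing a node which does not belong to the order-decomposition. -/
theorem StrongSafe.push_of_not {l : ℕ} {s : HStack (Linked G.Node) m} (h : StrongSafe l s)
    {a b : Linked G.Node} (hb : s.top1 = some b) {i : ℕ} (hE : Edge b.sym i a.sym)
    (ha : ¬ (a.sym.isLam = true ∧ l < a.sym.order)) : StrongSafe l (s.push1 a) := by
  have hp := h.isPath_push hb hE
  have hd : leveled l (s.push1 a).top2 = leveled l s.top2 := by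
    rw [HStack.push1, HStack.top2_setTop2, leveled, if_neg ha]
  cases h with
  | intro _ _ path link defined safe provides =>
    refine StrongSafe.intro l _ hp ?_ ?_ ?_ ?_ <;> simp only [prefixAt_push1, hd] <;> assumption

/-- Pushing a `λ`-node of the order-decomposition. -/
theorem StrongSafe.push_of_lt {l : ℕ} {s t : HStack (Linked G.Node) m} {a b : Linked G.Node}
    (h : StrongSafe a.sym.order s) (hb : s.top1 = some b) {i : ℕ} (hE : Edge b.sym i a.sym)
    (ha : a.sym.isLam = true ∧ l < a.sym.order) (hk : a.linkHeight = 1)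
    (hj : a.linkOrder ≤ G.order - a.sym.order + 1)
    (hc : (s.push1 a).pop a.linkOrder = some t) (ht : StrongSafe l t)
    (hprov : ∀ b, t.top1 = some b → Provides b.sym a.sym) : StrongSafe l (s.push1 a) := by
  have hp := h.isPath_push hb hE
  have hd : leveled l (s.push1 a).top2 = (l, ⟨a, s.top2⟩) :: leveled a.sym.order s.top2 := by
    rw [HStack.push1, HStack.top2_setTop2, leveled, if_pos ha]
  have hc' : (prefixAt s ⟨a, s.top2⟩).collapse = some t := by
    rw [collapse_prefixAt s hk]
    exact hc
  cases h with
  | intro _ _ path link defined safe provides =>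
    refine StrongSafe.intro l _ hp ?_ ?_ ?_ ?_ <;> simp only [prefixAt_push1, hd]
    · intro k x hx
      rcases List.mem_cons.1 hx with hx | hx
      · cases hx; exact ⟨hk, hj⟩
      · exact link k x hx
    · intro k x hx
      rcases List.mem_cons.1 hx with hx | hx
      · cases hx; exact ⟨t, hc'⟩
      · exact defined k x hx
    · intro k x r hx hr
      rcases List.mem_cons.1 hx with hx | hx
      · cases hx
        rw [hc'] at hr
        cases hr
        exact ht
      · exact safe k x r hx hr
    · intro k x r b hx hr hb
      rcases List.mem_cons.1 hx with hx | hx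
      · cases hx
        rw [hc'] at hr
        cases hr
        exact hprov b hb
      · exact provides k x r b hx hr hb

/-! ### Invariance under the steps of the automaton. -/

/-- Returning to the binder of a variable of order `l` and collapsing there. -/
theorem StrongSafe.return_binder (hG : G.IncrementallyBound) {s c t : HStack (Linked G.Node) m}
    {a b : Linked G.Node} {A : Ty} {d i : ℕ} {w' : G.Node} (h : StrongSafe A.order s)
    (ha : s.top1 = some a) (hA : a.sym.label = Label.var A d i)
    (hc : s.popIter 1 (span d) = some c) (ht : c.collapse = some t) (hb : t.top1 = some b)
    (hE : Edge b.sym (i + 1) w') :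
    StrongSafe A.order t ∧ w'.label = Label.lam A.args ∧
      ∃ e : Linked G.Node, A.order < e.sym.order ∧
        e.linkOrder ≤ G.order - e.sym.order + 1 ∧ c.pop e.linkOrder = some t := by
  cases h with
  | intro _ _ path link defined safe provides =>
    obtain ⟨x, hx⟩ := HStack.top1_eq_some.1 ha
    have hpath := path
    rw [hx, List.map_cons] at hpath
    have hidx := hG.findIdx? hpath hA
    rw [← List.map_cons, ← hx] at hidx
    obtain ⟨e, Y, hY, hmem⟩ := mem_leveled_of_findIdx? hidx
    have hcp : c = prefixAt s ⟨e, Y⟩ := by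
      rw [HStack.eq_of_popIter_one _ _ _ hc, hY]; rfl
    subst hcp
    obtain ⟨u, xs, hu, hxs, hi⟩ := hpath.label_binder hA
    -- The binder found by typing and the first λ-node of larger order both sit at position `span
    -- d`.
    have hue : u = e.sym := by
      rw [← List.map_cons, ← hx, List.getElem?_map, ← List.head?_drop, hY] at hu
      simpa [eq_comm] using hu
    obtain ⟨B, hB, hw'⟩ := provides _ _ _ _ hmem ht hb xs (hue ▸ hxs) i w' hE
    -- The binder declares its `i`-th variable with type `A`, so the operand provided there has type
    -- `A` too.
    rw [hi] at hB
    cases hB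
    obtain ⟨h1, h2⟩ := link _ _ hmem
    refine ⟨safe _ _ _ hmem ht, hw', e, (lt_of_mem_leveled hmem).2, h2, ?_⟩
    rw [← ht, collapse_prefixAt s h1]
    rfl

theorem StrongSafe.step (hG : G.IncrementallyBound) {c c' : HStack (Linked G.Node) m}
    (h : StrongSafe 0 c) (hs : Step c c') : StrongSafe 0 c' := by
  have hpath : ∀ a, c.top1 = some a → ∃ π, IsPath (a.sym :: π) := by
    intro a ha
    obtain ⟨x, hx⟩ := HStack.top1_eq_some.1 ha
    exact ⟨x.map Linked.sym, by simpa [hx] using h.isPath⟩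
  cases hs with
  | app a F w' ha hF hE =>
    by_cases hw : w'.isLam = true ∧ 0 < w'.order
    · refine (h.mono (Nat.zero_le _)).push_of_lt ha hE hw rfl (by simp) (t := c) ?_ h ?_
      · exact (HStack.pop_one _).2 ⟨_, _, HStack.top2_setTop2 _ _, by simp [HStack.push1]⟩
      · intro b hb xs hxs i v hv
        obtain rfl : a = b := Option.some.inj (ha.symm.trans hb)
        obtain ⟨π, hπ⟩ := hpath a ha
        obtain ⟨A, hA, hA'⟩ := hπ.label_operand_app hF hv
        have hroot : w' = G.root F := by
          generalize hi : (0 : ℕ) = i0 at hE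
          cases hE with
          | body => omega
          | operator F' hF' =>
            rw [hF] at hF'
            cases hF'
            rfl
          | operand => omega
        have hlab : w'.label = Label.lam (G.ty F).args := by
          rw [hroot]; rfl
        rw [hlab] at hxs
        cases hxs
        exact ⟨A, hA, hA'⟩
    · exact h.push_of_not ha hE hw
  | term a f i w' j k ha hf hi _ hE _ =>
    refine h.push_of_not ha hE ?_
    obtain ⟨π, hπ⟩ := hpath a ha
    obtain ⟨i, rfl⟩ := Nat.exists_eq_succ_of_ne_zero (Nat.one_le_iff_ne_zero.1 hi)
    -- Operands of a terminal are of ground type, hence dummy λ-nodes of order 0.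
    have := Node.order_of_label_lam (A := Ty.o) (hπ.label_operand_term hf hE)
    simp [this, Ty.order]
  | lam a xs w' j k ha hxs hE _ =>
    refine h.push_of_not ha hE ?_
    have hl := Node.isLam_iff.2 ⟨xs, hxs⟩
    generalize hi : 1 = i at hE
    cases hE with
    | body _ _ hl' => simp [hl']
    | operator => omega
    | operand _ _ hl' => simp [hl] at hl'
  | var_pos c₁ c₂ t a b A d i w' ha hA hpos hc₁ hc₂ ht hb hE =>
    obtain ⟨hj, hjm, hraised, hpop⟩ := HStack.dup_spec hc₁
    have h₁ : StrongSafe A.order c₁ :=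
      (h.mono (Nat.zero_le _)).topRaised hj hjm le_rfl hraised
    obtain ⟨x, hx⟩ := HStack.top1_eq_some.1 ha
    have ha₁ : c₁.top1 = some (HStack.raiseLink (G.order - A.order + 1) a) :=
      HStack.top1_eq_some.2 ⟨_, by rw [hraised.top2, hx, List.map_cons]⟩
    obtain ⟨hst, hw', e, he, hlink, hpope⟩ :=
      h₁.return_binder hG ha₁ (by simpa using hA) hc₂ ht hb hE
    have hord := Node.order_of_label_lam hw'
    -- The collapse at the binder popped at an order below n - l + 1, so the original below the copy
    -- is intact and one pop of order n - l + 1 recovers `c`.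
    have hpt : t.pop (G.order - A.order + 1) = some c := by
      refine HStack.pop_of_pop_lt (by omega) hpope ?_
      rw [HStack.eq_of_popIter_one _ _ _ hc₂, HStack.pop_setTop2 (by omega), hpop]
    refine StrongSafe.push_of_lt (t := c) (hord ▸ hst) hb hE
      ⟨Node.isLam_iff.2 ⟨_, hw'⟩, hord.symm ▸ hpos⟩ rfl (by simp [hord]) ?_ h ?_
    · change (t.push1 _).pop (G.order - A.order + 1) = some c
      rw [HStack.push1, HStack.pop_setTop2 (by omega), hpt]
    · intro b' hb' xs hxs k v hv
      obtain rfl : a = b' := Option.some.inj (ha.symm.trans hb')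
      obtain ⟨π, hπ⟩ := hpath a ha
      rw [hw'] at hxs
      cases hxs
      exact hπ.label_operand_var hA hv
  | var_zero c₂ t a b A d i w' j k ha hA hzero hc₂ ht hb hE _ =>
    obtain ⟨hst, hw', -⟩ :=
      StrongSafe.return_binder hG (hzero ▸ h) ha hA hc₂ ht hb hE
    -- With a variable of order 0 no duplication is needed: the configuration is already safe at the
    -- level of the variable.
    rw [hzero] at hst
    refine hst.push_of_not hb hE ?_
    simp [Node.order_of_label_lam hw', hzero]

theorem IsInitial.strongSafe {c : HStack (Linked G.Node) m} (h : IsInitial c) :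
    StrongSafe 0 c := by
  obtain ⟨j, k, _, rfl⟩ := h
  have hord : (G.root G.start).order = 0 := by
    rw [Node.order_of_label_lam (A := G.ty G.start) rfl, G.start_ty]; rfl
  have htop : ((HStack.bot m).push1 (⟨G.root G.start, j, k⟩ : Linked G.Node)).top2 =
      [⟨G.root G.start, j, k⟩] := by
    simp [HStack.push1]
  have hd : leveled 0 ([⟨G.root G.start, j, k⟩] : List (Linked G.Node)) = [] := by
    simp [leveled, hord]
  refine StrongSafe.intro 0 _ ?_ ?_ ?_ ?_ ?_
  · rw [htop]
    exact IsPath.root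
  all_goals simp [htop, hd]

theorem Reachable.strongSafe (hG : G.IncrementallyBound) {c : HStack (Linked G.Node) m}
    (h : Reachable c) : StrongSafe 0 c := by
  obtain ⟨c₀, h₀, hs⟩ := h
  induction hs with
  | refl => exact h₀.strongSafe
  | tail _ hstep ih => exact ih.step hG hstep

end Scheme

end Hors

theorem mainTheorem3 (G : Hors.Scheme.{u, v}) (hG : G.IncrementallyBound) (m : ℕ) (hm : G.order = m + 1)
    (c : Hors.HStack (Hors.Linked G.Node) m) (hc : Hors.Scheme.Reachable c) :
    Hors.Scheme.IsSafe c :=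
  (hc.strongSafe hG).lSafe
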